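/- Let $N, D \ge 0$ be integers. Let $A_N^D$ be the space of polynomial maps $P : \mathbb{R}^N \to \mathbb{R}^N$ of degree at most $D$, i.e. of maps $P(x) = \sum_{|\alpha| \le D} a_\alpha x^\alpha$ with coefficients $a_\alpha \in \mathbb{R}^N$, where $\alpha$ runs over the multi-indices in $\mathbb{Z}_{\ge 0}^N$ with $|\alpha| = \alpha_1 + \dots + \alpha_N \le D$ and $x^\alpha = x_1^{\alpha_1} \cdots x_N^{\alpha_N}$; identify $A_N^D$ with the finite-dimensional real vector space of the coefficient families $(a_\alpha)_{|\alpha| \le D}$ and equip it with Lebesgue measure. Fix $\lambda_0 \in \mathbb{C}$ with $|\lambda_0| = 1$. Then for Lebesgue-almost every $P \in A_N^D$ the map $P$ has no periodic orbit with eigenvalue $\lambda_0$; that is, there are no integer $k \ge 1$ and no point $x \in \mathbb{R}^N$ such that $P^{k}(x) = x$, where $P^k$ is the $k$-fold composition of $P$ with itself, and $\lambda_0$ is an eigenvalue of the (complexified) linearization $d_x(P^{k})$ of $P^k$ at $x$. -/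

import Mathlib

open MeasureTheory

/-- The multi-indices `α = (α₁, …, α_N)` of natural numbers with `|α| = ∑ᵢ αᵢ ≤ D`. -/
abbrev MultiIndex (N D : ℕ) : Type := {α : Fin N → ℕ // ∑ i, α i ≤ D}

instance MultiIndex.instFinite (N D : ℕ) : Finite (MultiIndex N D) := by
  refine Set.Finite.subset (Set.finite_Iic (fun _ : Fin N => D)) ?_
  intro α hα i
  exact (Finset.single_le_sum (f := α) (fun j _ => Nat.zero_le _) (Finset.mem_univ i)).trans hα

noncomputable instance MultiIndex.instFintype (N D : ℕ) : Fintype (MultiIndex N D) :=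
  Fintype.ofFinite _

/-- The space of polynomial maps `ℝ^N → ℝ^N` of degree at most `D`, identified with the
finite-dimensional real space of families `(a_α)_{|α| ≤ D}` of coefficients `a_α ∈ ℝ^N`.
Its `volume` is the Lebesgue (product) measure. -/
abbrev PolyMapSpace (N D : ℕ) : Type := MultiIndex N D → Fin N → ℝ

/-- The polynomial map `P(a, x) = ∑_{|α| ≤ D} x^α a_α`, where `x^α = x₁^{α₁} ⋯ x_N^{α_N}`. -/
noncomputable def polyMap {N D : ℕ} (a : PolyMapSpace N D) (x : Fin N → ℝ) : Fin N → ℝ :=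
  ∑ α : MultiIndex N D, (∏ i, x i ^ α.1 i) • a α

/-- The linearization (Jacobian) matrix of `f` at `x`, viewed as a complex matrix. -/
noncomputable def complexJacobian {N : ℕ} (f : (Fin N → ℝ) → Fin N → ℝ) (x : Fin N → ℝ) :
    Matrix (Fin N) (Fin N) ℂ :=
  (LinearMap.toMatrix' (fderiv ℝ f x : (Fin N → ℝ) →ₗ[ℝ] Fin N → ℝ)).map Complex.ofReal

/-- `f` has a periodic orbit with eigenvalue `z`: for some `k ≥ 1` there is a point `x` with
`f^k(x) = x` at which the linearization of the `k`-fold iterate `f^k` has `z` as an eigenvalue.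
The number `k` is any period of `x`, not only the least one. -/
def HasPeriodicOrbitWithEigenvalue {N : ℕ} (f : (Fin N → ℝ) → Fin N → ℝ) (z : ℂ) : Prop :=
  ∃ k : ℕ, 0 < k ∧ ∃ x : Fin N → ℝ, Function.IsPeriodicPt f k x ∧
    Module.End.HasEigenvalue (Matrix.toLin' (complexJacobian f^[k] x)) z

/-! Fix `k`. A `k`-periodic point with eigenvalue `lam₀` satisfies polynomial equations in the point
and the coefficients: periodicity and `resonance = 0`. It suffices to eliminate the point, that is,
to find a nonzero polynomial in the coefficients alone that vanishes whenever the system is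
solvable; its zero set is null, and there are countably many `k`.

For `D ≥ 2`, `exists_ne_zero_map_mem_ideal` reduces elimination to showing that the map with generic
coefficients has no resonant periodic point in any field. This is done by specializing to the power
map `x_i ↦ x_i ^ D`. A valuation ring centred at its coefficients contains every periodic point of
the generic map (`valuation_le_one_of_isPeriodicPt`), so a resonant one would reduce to a resonant
one of the power map. But the multipliers there are `0` or `D ^ k` times a root of unity, and the
Jacobian has only `0` and `D ^ k` on its diagonal (`resonance_powCoeff_ne_zero`). For `D ≤ 1` the
Jacobian does not depend on the point, so nothing has to be eliminated. -/

/-! ### Polynomial maps and their Jacobians over a commutative ring -/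

section Generic

variable {N D : ℕ} {S T : Type*} [CommRing S] [CommRing T]

/-- The polynomial map with coefficients `a` over a commutative ring. -/
noncomputable def evalPoly (a : MultiIndex N D → Fin N → S) (x : Fin N → S) : Fin N → S :=
  ∑ α : MultiIndex N D, (∏ i, x i ^ α.1 i) • a α

/-- The formal Jacobian matrix of `evalPoly a`. -/
noncomputable def polyJacobian (a : MultiIndex N D → Fin N → S) (x : Fin N → S) : Matrix (Fin N) (Fin N) S :=
  Matrix.of fun i j => ∑ α : MultiIndex N D,
    ((α.1 j : S) * x j ^ (α.1 j - 1) * ∏ l ∈ Finset.univ.erase j, x l ^ α.1 l) * a α i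

/-- The formal Jacobian matrix of the `n`-fold iterate of `evalPoly a`, given by the chain rule. -/
noncomputable def iterJacobian (a : MultiIndex N D → Fin N → S) : ℕ → (Fin N → S) → Matrix (Fin N) (Fin N) S
  | 0, _ => 1
  | n + 1, x => polyJacobian a ((evalPoly a)^[n] x) * iterJacobian a n x

/-- The determinant of `M ^ 2 - 2 c M + 1`. For real `M` and `c = re z` with `‖z‖ = 1` it is
the product of `det (M - z)` and its complex conjugate. -/
noncomputable def resonance (c : S) (M : Matrix (Fin N) (Fin N) S) : S := (M * M - (2 * c) • M + 1).det

lemma evalPoly_apply (a : MultiIndex N D → Fin N → S) (x : Fin N → S) (i : Fin N) :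
    evalPoly a x i = ∑ α : MultiIndex N D, (∏ j, x j ^ α.1 j) * a α i := by
  simp [evalPoly]

lemma evalPoly_add (a b : MultiIndex N D → Fin N → S) (x : Fin N → S) :
    evalPoly (a + b) x = evalPoly a x + evalPoly b x := by
  simp [evalPoly, Finset.sum_add_distrib]

lemma map_evalPoly (φ : S →+* T) (a : MultiIndex N D → Fin N → S) (x : Fin N → S) :
    φ ∘ evalPoly a x = evalPoly (fun α => φ ∘ a α) (φ ∘ x) := by
  ext i
  simp [evalPoly_apply]

lemma map_evalPoly_iterate (φ : S →+* T) (a : MultiIndex N D → Fin N → S) (x : Fin N → S)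
    (n : ℕ) : φ ∘ (evalPoly a)^[n] x = (evalPoly fun α => φ ∘ a α)^[n] (φ ∘ x) := by
  induction n with
  | zero => rfl
  | succ n ih => rw [Function.iterate_succ_apply', Function.iterate_succ_apply', ← ih, map_evalPoly]

lemma map_polyJacobian (φ : S →+* T) (a : MultiIndex N D → Fin N → S) (x : Fin N → S) :
    (polyJacobian a x).map φ = polyJacobian (fun α => φ ∘ a α) (φ ∘ x) := by
  ext i j
  simp [polyJacobian]

lemma map_iterJacobian (φ : S →+* T) (a : MultiIndex N D → Fin N → S) (x : Fin N → S) (n : ℕ) :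
    (iterJacobian a n x).map φ = iterJacobian (fun α => φ ∘ a α) n (φ ∘ x) := by
  induction n with
  | zero => simp [iterJacobian, Matrix.map_one]
  | succ n ih =>
    simp only [iterJacobian, Matrix.map_mul, ih, map_polyJacobian, map_evalPoly_iterate]

lemma map_resonance (φ : S →+* T) (c : S) (M : Matrix (Fin N) (Fin N) S) :
    φ (resonance c M) = resonance (φ c) (M.map φ) := by
  rw [resonance, RingHom.map_det, resonance]
  congr 1
  ext i j
  by_cases h : i = j <;> simp [Matrix.mul_apply, h, map_ofNat φ 2]

lemma resonance_diagonal (c : S) (d : Fin N → S) :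
    resonance c (Matrix.diagonal d) = ∏ i, (d i * d i - 2 * c * d i + 1) := by
  rw [resonance, ← Matrix.det_diagonal]
  congr 1
  ext i j
  by_cases h : i = j <;> simp [h]

lemma polyJacobian_eq_of_le_one (hD : D ≤ 1) (a : MultiIndex N D → Fin N → S)
    (x y : Fin N → S) : polyJacobian a x = polyJacobian a y := by
  ext i j
  simp only [polyJacobian, Matrix.of_apply]
  refine Finset.sum_congr rfl fun α _ => ?_
  have hsum : α.1 j + ∑ l ∈ Finset.univ.erase j, α.1 l ≤ 1 := by
    rw [Finset.add_sum_erase _ _ (Finset.mem_univ j)]; exact α.2.trans hD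
  rcases Nat.eq_zero_or_pos (α.1 j) with h | h
  · simp [h]
  · have h1 : α.1 j = 1 := by omega
    have h0 : ∑ l ∈ Finset.univ.erase j, α.1 l = 0 := by omega
    rw [Finset.sum_eq_zero_iff] at h0
    congr 2
    · simp [h1]
    · exact Finset.prod_congr rfl fun l hl => by simp [h0 l hl]

lemma iterJacobian_eq_of_le_one (hD : D ≤ 1) (a : MultiIndex N D → Fin N → S) (n : ℕ)
    (x y : Fin N → S) : iterJacobian a n x = iterJacobian a n y := by
  induction n with
  | zero => rfl
  | succ n ih =>
    simp only [iterJacobian, ih]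
    rw [polyJacobian_eq_of_le_one hD]

lemma polyJacobian_zero (x : Fin N → S) :
    polyJacobian (0 : MultiIndex N D → Fin N → S) x = 0 := by
  ext i j
  simp [polyJacobian]

variable (N D S) in
/-- The coefficients of the map `(x₁, …, x_N) ↦ (x₁ ^ D, …, x_N ^ D)`. -/
noncomputable def powCoeff : MultiIndex N D → Fin N → S := fun α i => if α.1 = Pi.single i D then 1 else 0

lemma sum_mul_powCoeff (i : Fin N) (f : (Fin N → ℕ) → S) :
    ∑ α : MultiIndex N D, f α.1 * powCoeff N D S α i = f (Pi.single i D) := by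
  have hi : ∑ j, (Pi.single i D : Fin N → ℕ) j ≤ D := by simp
  rw [Finset.sum_eq_single (⟨Pi.single i D, hi⟩ : MultiIndex N D)]
  · simp [powCoeff]
  · intro α _ hα
    have : α.1 ≠ Pi.single i D := fun h => hα (Subtype.ext h)
    simp [powCoeff, this]
  · simp

lemma evalPoly_powCoeff (x : Fin N → S) : evalPoly (powCoeff N D S) x = fun i => x i ^ D := by
  ext i
  rw [evalPoly_apply, sum_mul_powCoeff i fun α => ∏ j, x j ^ α j,
    Finset.prod_eq_single i (fun j _ h => by simp [h]) (by simp)]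
  simp

lemma evalPoly_powCoeff_iterate (x : Fin N → S) (n : ℕ) :
    (evalPoly (powCoeff N D S))^[n] x = fun i => x i ^ D ^ n := by
  induction n with
  | zero => simp
  | succ n ih =>
    rw [Function.iterate_succ_apply', ih, evalPoly_powCoeff]
    ext i
    rw [← pow_mul, pow_succ]

lemma polyJacobian_powCoeff (x : Fin N → S) :
    polyJacobian (powCoeff N D S) x = Matrix.diagonal fun i => (D : S) * x i ^ (D - 1) := by
  ext i j
  simp only [polyJacobian, Matrix.of_apply]
  rw [sum_mul_powCoeff i fun α => (α j : S) * x j ^ (α j - 1) *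
    ∏ l ∈ Finset.univ.erase j, x l ^ α l]
  by_cases h : i = j
  · subst h
    rw [Finset.prod_eq_one fun l hl => by simp [(Finset.mem_erase.1 hl).1]]
    simp
  · simp [h, Ne.symm h]

lemma iterJacobian_powCoeff (hD : 0 < D) (x : Fin N → S) (n : ℕ) :
    iterJacobian (powCoeff N D S) n x =
      Matrix.diagonal fun i => (D : S) ^ n * x i ^ (D ^ n - 1) := by
  induction n with
  | zero => simp [iterJacobian]
  | succ n ih =>
    rw [iterJacobian, ih, evalPoly_powCoeff_iterate, polyJacobian_powCoeff,
      Matrix.diagonal_mul_diagonal]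
    congr 1
    ext i
    have h1 : D ^ n * (D - 1) + (D ^ n - 1) = D ^ (n + 1) - 1 := by
      have := Nat.one_le_pow n D hD
      obtain ⟨m, rfl⟩ := Nat.exists_eq_add_of_lt hD
      simp only [zero_add, Nat.add_sub_cancel, pow_succ] at *
      rw [mul_add, mul_one]; omega
    rw [← h1, pow_add (x i), pow_mul, pow_succ]
    ring

end Generic

/-! ### The derivative of iterates of a real polynomial map -/

section Real

variable {N D : ℕ}

lemma hasFDerivAt_polyMap (a : PolyMapSpace N D) (x : Fin N → ℝ) :
    HasFDerivAt (polyMap a) (Matrix.toLin' (polyJacobian a x)).toContinuousLinearMap x := by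
  rw [hasFDerivAt_pi']
  intro i
  have h (α : MultiIndex N D) : HasFDerivAt (fun y : Fin N → ℝ => (∏ j, y j ^ α.1 j) * a α i) _ x :=
    (HasFDerivAt.finsetProd (u := Finset.univ) fun j _ =>
      (hasFDerivAt_apply (𝕜 := ℝ) j x).pow (α.1 j)).mul_const (a α i)
  have h' := HasFDerivAt.fun_sum (u := Finset.univ) fun α _ => h α
  refine (h'.congr_of_eventuallyEq (.of_forall fun y => ?_)).congr_fderiv ?_
  · exact evalPoly_apply a y i
  · ext v
    simp only [polyJacobian, Matrix.toLin'_apply, Matrix.mulVec, dotProduct,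
      sum_apply, smul_apply, ContinuousLinearMap.comp_apply,
      ContinuousLinearMap.proj_apply, LinearMap.coe_toContinuousLinearMap', Matrix.of_apply,
      smul_eq_mul, Finset.mul_sum, Finset.sum_mul]
    rw [Finset.sum_comm]
    refine Finset.sum_congr rfl fun j _ => Finset.sum_congr rfl fun α _ => ?_
    simp
    ring

lemma hasFDerivAt_polyMap_iterate (a : PolyMapSpace N D) (x : Fin N → ℝ) (n : ℕ) :
    HasFDerivAt (polyMap a)^[n] (Matrix.toLin' (iterJacobian a n x)).toContinuousLinearMap x := by
  induction n with
  | zero =>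
    refine (hasFDerivAt_id x).congr_fderiv ?_
    ext v
    simp [iterJacobian]
  | succ n ih =>
    rw [Function.iterate_succ']
    refine ((hasFDerivAt_polyMap a _).comp x ih).congr_fderiv ?_
    ext v
    simp [iterJacobian]
    rfl

lemma complexJacobian_polyMap_iterate (a : PolyMapSpace N D) (x : Fin N → ℝ) (n : ℕ) :
    complexJacobian (polyMap a)^[n] x = (iterJacobian a n x).map Complex.ofRealHom := by
  rw [complexJacobian, (hasFDerivAt_polyMap_iterate a x n).fderiv]
  simp
  rfl

/-- Since `z * conj z = 1`, `z` is a root of `T ^ 2 - 2 (re z) T + 1`, so an eigenvector for `z` is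
killed by this real quadratic in `M`. -/
lemma resonance_eq_zero_of_hasEigenvalue (M : Matrix (Fin N) (Fin N) ℝ) {z : ℂ} (hz : ‖z‖ = 1)
    (h : Module.End.HasEigenvalue (Matrix.toLin' (M.map Complex.ofRealHom)) z) :
    resonance z.re M = 0 := by
  obtain ⟨v, hv, hv0⟩ := h.exists_hasEigenvector
  rw [Module.End.mem_eigenspace_iff, Matrix.toLin'_apply] at hv
  have hquad : z * z - 2 * (z.re : ℂ) * z + 1 = 0 := by
    have h1 : z * (starRingEnd ℂ) z = 1 := by simp [Complex.mul_conj, Complex.normSq_eq_norm_sq, hz]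
    have h2 : z + (starRingEnd ℂ) z = 2 * (z.re : ℂ) := by simpa using Complex.add_conj z
    rw [← h2, ← h1]; ring
  have : (resonance (z.re : ℂ) (M.map Complex.ofRealHom)) = 0 := by
    refine Matrix.exists_mulVec_eq_zero_iff.1 ⟨v, hv0, ?_⟩
    rw [Matrix.add_mulVec, Matrix.sub_mulVec, ← Matrix.mulVec_mulVec, Matrix.smul_mulVec, hv,
      Matrix.mulVec_smul, hv, Matrix.one_mulVec, smul_smul, smul_smul, ← sub_smul]
    nth_rw 2 [← one_smul ℂ v]
    rw [← add_smul, hquad, zero_smul]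
  have h3 := map_resonance Complex.ofRealHom z.re M
  rw [show Complex.ofRealHom z.re = (z.re : ℂ) from rfl, this] at h3
  exact Complex.ofReal_eq_zero.1 h3

end Real

/-! ### Elimination -/

/-- If an ideal of an `R`-algebra has no common zero in a field containing `R`, then it contains
the image of a nonzero element of `R`. -/
lemma exists_ne_zero_map_mem_ideal {R : Type*} {B : Type*} [CommRing R] [IsDomain R] [CommRing B]
    (f : R →+* B) (I : Ideal B)
    (h : ∀ p : Ideal B, ∀ [p.IsPrime], ∀ Φ : B →+* FractionRing (B ⧸ p), (∀ b ∈ I, Φ b = 0) →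
      ¬ Function.Injective (Φ.comp f)) :
    ∃ r : R, r ≠ 0 ∧ f r ∈ I := by
  by_contra! hI
  have hdisj : Disjoint (I : Set B) ((nonZeroDivisors R).map f : Submonoid B) := by
    rw [Set.disjoint_left]
    rintro _ hb ⟨r, hr, rfl⟩
    exact hI r (nonZeroDivisors.ne_zero hr) hb
  obtain ⟨p, hp, hIp, hpS⟩ := Ideal.exists_le_prime_disjoint I _ hdisj
  have hinj := IsFractionRing.injective (B ⧸ p) (FractionRing (B ⧸ p))
  refine h p ((algebraMap (B ⧸ p) (FractionRing (B ⧸ p))).comp (Ideal.Quotient.mk p)) ?_ ?_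
  · intro b hb
    simp [Ideal.Quotient.eq_zero_iff_mem.2 (hIp hb)]
  · rw [injective_iff_map_eq_zero]
    intro r hr
    by_contra hr0
    have hrp : f r ∈ p := Ideal.Quotient.eq_zero_iff_mem.1 (hinj (by simpa using hr))
    exact Set.disjoint_left.1 hpS hrp ⟨r, mem_nonZeroDivisors_of_ne_zero hr0, rfl⟩

/-- A ring homomorphism `ev : R → k` to a field and an embedding of `R` into a field `L` give a
valuation ring of `L` centred at the kernel of `ev`. -/
lemma exists_valuationSubring_centered {R k L : Type*} [CommRing R] [Field k] [Field L]
    (ev : R →+* k) (g : R →+* L) (hg : Function.Injective g) :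
    ∃ V : ValuationSubring L, (∀ r, g r ∈ V) ∧ ∀ r, ev r = 0 → V.valuation (g r) < 1 := by
  have hne : (RingHom.ker ev).map g.rangeRestrict ≠ ⊤ := by
    rw [Ideal.ne_top_iff_one,
      Ideal.mem_map_iff_of_surjective _ g.rangeRestrict_surjective]
    rintro ⟨r, hr, hr1⟩
    have : r = 1 := hg (by simpa using congrArg Subtype.val hr1)
    simp [this, RingHom.mem_ker] at hr
  obtain ⟨V, hV, hI⟩ := Ideal.image_subset_nonunits_valuationSubring _ hne
  refine ⟨V, fun r => hV ⟨r, rfl⟩, fun r hr => ?_⟩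
  rw [← ValuationSubring.mem_nonunits_iff]
  exact hI ⟨g.rangeRestrict r, Ideal.mem_map_of_mem _ hr, rfl⟩

/-! ### Perturbations of the power map over a valued field -/

section Valued

variable {N D : ℕ} {L Γ : Type*} [Field L] [LinearOrderedCommGroupWithZero Γ] (v : Valuation L Γ)

/-- At a coordinate `m` of largest valuation, `y m ^ D` strictly dominates the perturbation, and `D
≥ 2` makes it exceed every coordinate of `y`. -/
lemma exists_valuation_lt_evalPoly (hD : 2 ≤ D) {a : MultiIndex N D → Fin N → L}
    (ha : ∀ α i, v (a α i - powCoeff N D L α i) < 1) {y : Fin N → L} {i : Fin N}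
    (hi : 1 < v (y i)) : ∃ m, ∀ j, v (y j) < v (evalPoly a y m) := by
  have : Nonempty (Fin N) := ⟨i⟩
  obtain ⟨m, hm⟩ := Finite.exists_max fun j => v (y j)
  have hr : 1 < v (y m) := hi.trans_le (hm i)
  have hr0 : v (y m) ≠ 0 := (zero_lt_one.trans hr).ne'
  have hsmall : v (evalPoly (a - powCoeff N D L) y m) < v (y m ^ D) := by
    rw [evalPoly_apply]
    refine Valuation.map_sum_lt v (by simp [hr0]) fun α _ => ?_
    have hmon : v (∏ j, y j ^ α.1 j) ≤ v (y m) ^ D := by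
      rw [map_prod]
      calc ∏ j, v (y j ^ α.1 j) ≤ ∏ j, v (y m) ^ α.1 j :=
            Finset.prod_le_prod' fun j _ => by rw [map_pow]; exact pow_le_pow_left' (hm j) _
        _ = v (y m) ^ ∑ j, α.1 j := Finset.prod_pow_eq_pow_sum _ _ _
        _ ≤ v (y m) ^ D := pow_le_pow_right' hr.le α.2
    rw [map_mul, map_pow]
    calc v (∏ j, y j ^ α.1 j) * v ((a - powCoeff N D L) α m)
        ≤ v (y m) ^ D * v ((a - powCoeff N D L) α m) := mul_le_mul_left hmon _
      _ < v (y m) ^ D * 1 :=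
        mul_lt_mul_of_pos_left (ha α m) (zero_lt_iff.2 (pow_ne_zero _ hr0))
      _ = v (y m) ^ D := mul_one _
  refine ⟨m, fun j => (hm j).trans_lt ?_⟩
  have hsplit : evalPoly a y m = y m ^ D + evalPoly (a - powCoeff N D L) y m := by
    conv_lhs => rw [← add_sub_cancel (powCoeff N D L) a, evalPoly_add]
    simp [evalPoly_powCoeff]
  rw [hsplit, Valuation.map_add_eq_of_lt_left v hsmall, map_pow]
  exact lt_self_pow₀ hr (by omega)

/-- Otherwise the largest valuation of a coordinate would grow strictly along the orbit, which could
never return. -/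
lemma valuation_le_one_of_isPeriodicPt (hD : 2 ≤ D) {a : MultiIndex N D → Fin N → L}
    (ha : ∀ α i, v (a α i - powCoeff N D L α i) < 1) {y : Fin N → L} {k : ℕ} (hk : 0 < k)
    (hy : Function.IsPeriodicPt (evalPoly a) k y) (i : Fin N) : v (y i) ≤ 1 := by
  by_contra! hi
  have key (n : ℕ) : ∃ m, ∀ j, v (y j) < v ((evalPoly a)^[n + 1] y m) := by
    induction n with
    | zero => exact exists_valuation_lt_evalPoly v hD ha hi
    | succ n ih =>
      obtain ⟨m, hm⟩ := ih
      obtain ⟨l, hl⟩ := exists_valuation_lt_evalPoly v hD ha (hi.trans (hm i))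
      rw [Function.iterate_succ_apply']
      exact ⟨l, fun j => (hm j).trans (hl m)⟩
  obtain ⟨m, hm⟩ := key (k - 1)
  rw [Nat.sub_add_cancel hk, hy.eq] at hm
  exact lt_irrefl _ (hm m)

end Valued

/-- The periodic points of the power map over an extension field of `ℝ` have no multiplier that
is a complex number of modulus `1`. -/
lemma resonance_powCoeff_ne_zero {N D k : ℕ} (hD : 2 ≤ D) (hk : 0 < k) {κ : Type*} [Field κ]
    (η : ℝ →+* κ) {c : ℝ} (hc : |c| ≤ 1) {x : Fin N → κ}
    (hx : Function.IsPeriodicPt (evalPoly (powCoeff N D κ)) k x) :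
    resonance (η c) (iterJacobian (powCoeff N D κ) k x) ≠ 0 := by
  rw [iterJacobian_powCoeff (by omega), resonance_diagonal, Finset.prod_ne_zero_iff]
  intro i _
  have hDk : 1 < D ^ k := Nat.one_lt_pow hk.ne' (by omega)
  have hxi : x i ^ D ^ k = x i := by
    have := congrFun hx.eq i
    rwa [evalPoly_powCoeff_iterate] at this
  by_cases h0 : x i = 0
  · simp [h0, zero_pow (show D ^ k - 1 ≠ 0 by omega)]
  · have h1 : x i ^ (D ^ k - 1) = 1 := by
      refine mul_right_cancel₀ h0 ?_
      rw [← pow_succ, Nat.sub_add_cancel hDk.le, hxi, one_mul]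
    -- As `c ≤ 1`, the left side is at least `(D ^ k - 1) ^ 2 > 0`.
    have hreal : (D : ℝ) ^ k * (D : ℝ) ^ k - 2 * c * (D : ℝ) ^ k + 1 ≠ 0 := by
      have hDk' : (1 : ℝ) < (D : ℝ) ^ k := by exact_mod_cast hDk
      have hc' := (abs_le.1 hc).2
      nlinarith [mul_nonneg (sub_nonneg.2 hc') (zero_le_one.trans hDk'.le)]
    have := (map_ne_zero η).2 hreal
    simpa [h1, map_ofNat η 2] using this

/-- Over a field containing the generic coefficients, the generic polynomial map of degree
`D ≥ 2` has no periodic point with a multiplier of modulus `1` in `ℂ`. -/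
lemma resonance_generic_ne_zero {N D k : ℕ} (hD : 2 ≤ D) (hk : 0 < k) {L : Type*} [Field L]
    (g : MvPolynomial (MultiIndex N D × Fin N) ℝ →+* L) (hg : Function.Injective g)
    {c : ℝ} (hc : |c| ≤ 1) {x : Fin N → L}
    (hx : Function.IsPeriodicPt (evalPoly fun α i => g (MvPolynomial.X (α, i))) k x) :
    resonance (g (MvPolynomial.C c))
      (iterJacobian (fun (α : MultiIndex N D) i => g (MvPolynomial.X (α, i))) k x) ≠ 0 := by
  intro hres
  set ev : MvPolynomial (MultiIndex N D × Fin N) ℝ →+* ℝ :=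
    MvPolynomial.eval fun s => powCoeff N D ℝ s.1 s.2 with hev
  obtain ⟨V, hgV, hV⟩ := exists_valuationSubring_centered ev g hg
  have hpow (α : MultiIndex N D) (i : Fin N) :
      MvPolynomial.C (powCoeff N D ℝ α i) =
        powCoeff N D (MvPolynomial (MultiIndex N D × Fin N) ℝ) α i := by
    unfold powCoeff; split_ifs <;> simp
  have hpowL (α : MultiIndex N D) (i : Fin N) :
      g (powCoeff N D (MvPolynomial (MultiIndex N D × Fin N) ℝ) α i) = powCoeff N D L α i := by
    unfold powCoeff; split_ifs <;> simp
  have ha (α : MultiIndex N D) (i : Fin N) :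
      V.valuation (g (MvPolynomial.X (α, i)) - powCoeff N D L α i) < 1 := by
    rw [← hpowL, ← hpow, ← map_sub]
    exact hV _ (by simp [hev])
  have hxV (i : Fin N) : x i ∈ V := by
    rw [← V.valuation_le_one_iff]
    exact valuation_le_one_of_isPeriodicPt _ hD ha hk hx i
  let g' : MvPolynomial (MultiIndex N D × Fin N) ℝ →+* V := g.codRestrict V.toSubring hgV
  let x' : Fin N → V := fun i => ⟨x i, hxV i⟩
  let a' : MultiIndex N D → Fin N → V := fun α i => g' (MvPolynomial.X (α, i))
  have hx' : (evalPoly a')^[k] x' = x' := by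
    have h := map_evalPoly_iterate V.subtype a' x' k
    ext i
    exact congrFun (h.trans hx.eq) i
  have hres' : resonance (g' (MvPolynomial.C c)) (iterJacobian a' k x') = 0 := by
    refine Subtype.ext ?_
    have h := map_resonance V.subtype (g' (MvPolynomial.C c)) (iterJacobian a' k x')
    rw [map_iterJacobian] at h
    exact h.trans hres
  -- Modulo the maximal ideal the generic coefficients become those of the power map.
  let π : V →+* IsLocalRing.ResidueField V := IsLocalRing.residue V
  have hπ (r) (hr : ev r = 0) : π (g' r) = 0 := by
    rw [IsLocalRing.residue_eq_zero_iff]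
    exact (V.valuation_lt_one_iff (g' r)).2 (hV r hr)
  have haπ : (fun α => π ∘ a' α) = powCoeff N D (IsLocalRing.ResidueField V) := by
    ext α i
    have h : π (g' (MvPolynomial.X (α, i) - MvPolynomial.C (powCoeff N D ℝ α i))) = 0 :=
      hπ _ (by simp [hev])
    rw [map_sub, map_sub, sub_eq_zero] at h
    refine h.trans ?_
    rw [hpow]
    unfold powCoeff; split_ifs <;> simp
  have hper : Function.IsPeriodicPt (evalPoly (powCoeff N D (IsLocalRing.ResidueField V))) k
      (π ∘ x') := by
    have h := map_evalPoly_iterate π a' x' k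
    rw [hx', haπ] at h
    exact h.symm
  refine resonance_powCoeff_ne_zero hD hk ((π.comp g').comp MvPolynomial.C) hc hper ?_
  have h := map_resonance π (g' (MvPolynomial.C c)) (iterJacobian a' k x')
  rw [map_iterJacobian, hres', haπ, map_zero] at h
  exact h.symm

/-! ### The exceptional polynomial -/

/-- For every `k`, the coefficients of maps with a resonant `k`-periodic point lie on a proper
real algebraic hypersurface. -/
lemma exists_mvPolynomial_vanishing_of_resonance (N D : ℕ) {k : ℕ} (hk : 0 < k) {c : ℝ}
    (hc : |c| ≤ 1) : ∃ F : MvPolynomial (MultiIndex N D × Fin N) ℝ, F ≠ 0 ∧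
      ∀ (a : PolyMapSpace N D) (x : Fin N → ℝ), Function.IsPeriodicPt (evalPoly a) k x →
        resonance c (iterJacobian a k x) = 0 → MvPolynomial.eval (fun s => a s.1 s.2) F = 0 := by
  let a₀ : MultiIndex N D → Fin N → MvPolynomial (MultiIndex N D × Fin N) ℝ :=
    fun α i => MvPolynomial.X (α, i)
  rcases Nat.lt_or_ge D 2 with hD | hD
  · have hF (a : PolyMapSpace N D) : MvPolynomial.eval (fun s => a s.1 s.2)
        (resonance (MvPolynomial.C c) (iterJacobian a₀ k 0)) =
          resonance c (iterJacobian a k 0) := by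
      rw [map_resonance, map_iterJacobian]
      congr 2
      · simp
      · ext α i
        simp [a₀]
    refine ⟨resonance (MvPolynomial.C c) (iterJacobian a₀ k 0), fun h0 => ?_, fun a x _ hr => ?_⟩
    -- At zero coefficients the Jacobian of a positive iterate is zero, so the resonance is `det 1 =
    -- 1`.
    · have h := hF 0
      obtain ⟨n, rfl⟩ := Nat.exists_eq_succ_of_ne_zero hk.ne'
      have hJ : iterJacobian (0 : PolyMapSpace N D) (n + 1) 0 = 0 := by
        rw [iterJacobian, polyJacobian_zero, zero_mul]
      rw [h0, map_zero, hJ] at h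
      simp [resonance] at h
    · rw [hF, iterJacobian_eq_of_le_one (by omega) a k 0 x, hr]
  · let C := MvPolynomial.C (R := MvPolynomial (MultiIndex N D × Fin N) ℝ) (σ := Fin N)
    let a₁ : MultiIndex N D → Fin N → MvPolynomial (Fin N) _ := fun α => C ∘ a₀ α
    let x₁ : Fin N → MvPolynomial (Fin N) (MvPolynomial (MultiIndex N D × Fin N) ℝ) :=
      MvPolynomial.X
    let r₁ := resonance (C (MvPolynomial.C c)) (iterJacobian a₁ k x₁)
    let I := Ideal.span (insert r₁ (Set.range fun i => (evalPoly a₁)^[k] x₁ i - x₁ i))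
    obtain ⟨F, hF0, hF⟩ := exists_ne_zero_map_mem_ideal C I (by
      intro p _ Φ hΦ hinj
      have hΦx : Function.IsPeriodicPt (evalPoly fun α => Φ ∘ a₁ α) k (Φ ∘ x₁) := by
        have h := map_evalPoly_iterate Φ a₁ x₁ k
        refine h.symm.trans ?_
        ext i
        have := hΦ _ (Ideal.subset_span (Set.mem_insert_of_mem _ ⟨i, rfl⟩))
        simpa [sub_eq_zero] using this
      refine resonance_generic_ne_zero hD hk (Φ.comp C) hinj hc hΦx ?_
      have h := hΦ r₁ (Ideal.subset_span (Set.mem_insert _ _))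
      rw [map_resonance, map_iterJacobian] at h
      exact h)
    refine ⟨F, hF0, fun a x hx hr => ?_⟩
    let Ψ : MvPolynomial (Fin N) (MvPolynomial (MultiIndex N D × Fin N) ℝ) →+* ℝ :=
      MvPolynomial.eval₂Hom (MvPolynomial.eval fun s => a s.1 s.2) x
    have ha : (fun α => Ψ ∘ a₁ α) = a := by
      ext α i
      simp [Ψ, a₁, a₀, C]
    have hx₁ : Ψ ∘ x₁ = x := by
      ext i
      simp [Ψ, x₁]
    have hle : I ≤ RingHom.ker Ψ := by
      rw [Ideal.span_le, Set.insert_subset_iff]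
      refine ⟨?_, ?_⟩
      · rw [SetLike.mem_coe, RingHom.mem_ker, map_resonance, map_iterJacobian, ha, hx₁]
        simpa [Ψ, C] using hr
      · rintro _ ⟨i, rfl⟩
        have h := map_evalPoly_iterate Ψ a₁ x₁ k
        rw [ha, hx₁, hx.eq, ← hx₁] at h
        simpa [RingHom.mem_ker, sub_eq_zero] using congrFun h i
    simpa [Ψ, C, RingHom.mem_ker] using hle hF

/-! ### Zero sets of polynomials are null -/

lemma natDegree_prod_linear_pow_le {σ R : Type*} [CommRing R] (t : Finset σ) (b v : σ → R)
    (s : σ → ℕ) :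
    (∏ i ∈ t, (Polynomial.C (b i) + Polynomial.X * Polynomial.C (v i)) ^ s i).natDegree
      ≤ ∑ i ∈ t, s i := by
  refine (Polynomial.natDegree_prod_le _ _).trans (Finset.sum_le_sum fun i _ => ?_)
  have hlin : (Polynomial.C (b i) + Polynomial.X * Polynomial.C (v i)).natDegree ≤ 1 := by
    compute_degree
  exact (Polynomial.natDegree_pow_le.trans (Nat.mul_le_mul_left (s i) hlin)).trans (by simp)

lemma coeff_prod_linear_pow {σ R : Type*} [CommRing R] (t : Finset σ) (b v : σ → R)
    (s : σ → ℕ) :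
    (∏ i ∈ t, (Polynomial.C (b i) + Polynomial.X * Polynomial.C (v i)) ^ s i).coeff
      (∑ i ∈ t, s i) = ∏ i ∈ t, v i ^ s i := by
  classical
  induction t using Finset.induction_on with
  | empty => simp
  | insert i t hi ih =>
    have hlin : (Polynomial.C (b i) + Polynomial.X * Polynomial.C (v i)).natDegree ≤ 1 := by
      compute_degree
    rw [Finset.prod_insert hi, Finset.sum_insert hi, Finset.prod_insert hi,
      Polynomial.coeff_mul_add_eq_of_natDegree_le
        ((Polynomial.natDegree_pow_le.trans (Nat.mul_le_mul_left (s i) hlin)).trans (by simp))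
        (natDegree_prod_linear_pow_le t b v s), ih]
    have := Polynomial.coeff_pow_of_natDegree_le (m := s i) hlin
    rw [mul_one] at this
    rw [this]
    simp

/-- Along a direction at which its leading form does not vanish, a polynomial has finitely many
zeros on every line. -/
lemma MvPolynomial.exists_direction_finite_zeros {σ R : Type*} [Fintype σ] [CommRing R]
    [IsDomain R] [Infinite R] {F : MvPolynomial σ R} (hF : F ≠ 0) :
    ∃ v : σ → R, ∀ b : σ → R, {t : R | MvPolynomial.eval (b + t • v) F = 0}.Finite := by
  set d := F.totalDegree
  have hlead : MvPolynomial.homogeneousComponent d F ≠ 0 := by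
    obtain ⟨s, hs, hsd⟩ := F.support.exists_mem_eq_sup (MvPolynomial.support_nonempty.2 hF)
      fun s => s.sum fun _ e => e
    intro h0
    have h := MvPolynomial.coeff_homogeneousComponent d F s
    rw [h0, MvPolynomial.coeff_zero, if_pos] at h
    · exact MvPolynomial.mem_support_iff.1 hs h.symm
    · exact hsd.symm
  obtain ⟨v, hv⟩ : ∃ v, MvPolynomial.eval v (MvPolynomial.homogeneousComponent d F) ≠ 0 := by
    by_contra! h
    exact hlead (MvPolynomial.funext fun x => by simpa using h x)
  refine ⟨v, fun b => ?_⟩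
  let p : Polynomial R := MvPolynomial.eval₂ Polynomial.C
    (fun i => Polynomial.C (b i) + Polynomial.X * Polynomial.C (v i)) F
  -- The coefficient of `t ^ d` in `F (b + t v)` is the leading form at `v`, independent of `b`.
  have hcoeff : p.coeff d = MvPolynomial.eval v (MvPolynomial.homogeneousComponent d F) := by
    rw [MvPolynomial.homogeneousComponent_apply, map_sum, Finset.sum_filter]
    simp only [p]
    rw [MvPolynomial.eval₂_eq', Polynomial.finsetSum_coeff]
    refine Finset.sum_congr rfl fun s hs => ?_
    have hdeg : s.degree = ∑ i, s i := Finsupp.degree_eq_sum s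
    have hle : s.degree ≤ d := by
      have := MvPolynomial.le_totalDegree hs
      rwa [hdeg, ← Finsupp.sum_fintype s (fun _ e => e) (by simp)]
    rw [Polynomial.coeff_C_mul]
    split_ifs with h
    · rw [MvPolynomial.eval_monomial, ← h, hdeg, coeff_prod_linear_pow,
        Finsupp.prod_fintype _ _ (by simp)]
    · rw [Polynomial.coeff_eq_zero_of_natDegree_lt, mul_zero]
      refine (natDegree_prod_linear_pow_le _ b v s).trans_lt ?_
      rw [← hdeg]
      exact lt_of_le_of_ne hle h
  have hp : p ≠ 0 := fun h => hv (by rw [← hcoeff, h, Polynomial.coeff_zero])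
  refine (Polynomial.finite_setOfPred_isRoot hp).subset fun t ht => ?_
  have heval : p.eval t = MvPolynomial.eval (b + t • v) F := by
    rw [← Polynomial.coe_evalRingHom]
    simp only [p]
    rw [MvPolynomial.hom_eval₂, MvPolynomial.eval, MvPolynomial.coe_eval₂Hom]
    congr 1
    · ext; simp
    · ext i; simpa using mul_comm _ _
  exact heval.trans ht

lemma ae_eval_mvPolynomial_ne_zero {N D : ℕ} {F : MvPolynomial (MultiIndex N D × Fin N) ℝ}
    (hF : F ≠ 0) :
    ∀ᵐ a : PolyMapSpace N D, MvPolynomial.eval (fun s => a s.1 s.2) F ≠ 0 := by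
  obtain ⟨v, hv⟩ := F.exists_direction_finite_zeros hF
  have hcont : Continuous fun a : PolyMapSpace N D =>
      MvPolynomial.eval (fun s => a s.1 s.2) F :=
    (MvPolynomial.continuous_eval F).comp (by fun_prop)
  let w : PolyMapSpace N D := fun α i => v (α, i)
  -- Fubini: it is enough that every line in direction `w` meets the zero set in a null set.
  refine ae_mem_of_ae_add_linearMap_mem (LinearMap.toSpanSingleton ℝ _ w) volume volume
    (s := {a | MvPolynomial.eval (fun s => a s.1 s.2) F ≠ 0})
    (isOpen_ne_fun hcont continuous_const).measurableSet fun b => ?_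
  have hnull := (hv fun s => b s.1 s.2).measure_zero (volume : Measure ℝ)
  filter_upwards [measure_eq_zero_iff_ae_notMem.1 hnull] with t ht
  exact ht

theorem lemma1 (N D : ℕ) (lam₀ : ℂ) (hlam₀ : ‖lam₀‖ = 1) :
    ∀ᵐ a : PolyMapSpace N D ∂volume, ¬ HasPeriodicOrbitWithEigenvalue (polyMap a) lam₀ := by
  have hc : |lam₀.re| ≤ 1 := hlam₀ ▸ Complex.abs_re_le_norm lam₀
  have h : ∀ᵐ a : PolyMapSpace N D, ∀ k, 0 < k → ∀ x, Function.IsPeriodicPt (evalPoly a) k x →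
      resonance lam₀.re (iterJacobian a k x) ≠ 0 := by
    rw [ae_all_iff]
    intro k
    by_cases hk : 0 < k
    · obtain ⟨F, hF, hFz⟩ := exists_mvPolynomial_vanishing_of_resonance N D hk hc
      filter_upwards [ae_eval_mvPolynomial_ne_zero hF] with a ha _ x hx hr
      exact ha (hFz a x hx hr)
    · exact .of_forall fun a h => absurd h hk
  filter_upwards [h] with a ha
  rintro ⟨k, hk, x, hx, hev⟩
  rw [complexJacobian_polyMap_iterate] at hev
  exact ha k hk x hx (resonance_eq_zero_of_hasEigenvalue _ hlam₀ hev)
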